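/- Let $G$ be an infinite compact (Hausdorff) topological group, let $g\in G$ be a generator of $G$, i.e. the cyclic subgroup $\{g^n : n\in\mathbb Z\}$ is dense in $G$ (so $G$ is monothetic), and let $\nu$ be the normalized Haar measure of $G$, i.e. the regular translation-invariant Borel measure with $\nu(G)=1$. Let $\mathbb K$ be $\mathbb R$ or $\mathbb C$, let $C(G)$ be the space of continuous functions $G\to\mathbb K$ with the uniform norm, and let $C^0(G)=\{\gamma\in C(G) : \int_G\gamma\,d\nu=0\}$. For $\gamma\in C(G)$ consider the cohomological equation $$\varphi(gx)-\varphi(x)=\gamma(x),\qquad x\in G. \tag{$*$}$$ A measurable solution of $(*)$ is a function $\varphi:G\to\mathbb K$, measurable with respect to the completion of $\nu$, that satisfies $(*)$ for $\nu$-almost every $x\in G$. Then there is a function $\gamma\in C^0(G)$ for which $(*)$ has no measurable solution. Moreover, the set of all $\gamma\in C^0(G)$ for which $(*)$ has a measurable solution is of first Baire category (meagre) in $C^0(G)$, and the set of all $\gamma\in C^0(G)$ for which $(*)$ has no measurable solution is of second Baire category (not meagre) in $C^0(G)$. -/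

import Mathlib

open MeasureTheory

/-- `g` is a generator of the monothetic topological group `G`: the cyclic subgroup
`{g ^ n : n ∈ ℤ}` is dense in `G`. -/
def IsMonotheticGenerator {G : Type*} [Group G] [TopologicalSpace G] (g : G) : Prop :=
  Dense (Subgroup.zpowers g : Set G)

/-- The cohomological equation `φ (g x) - φ x = γ x` has a measurable solution. Measurability is
with respect to the completion of `ν` (for functions with values in `ℝ` or `ℂ` this is
`AEMeasurable`), and the equation is required `ν`-almost everywhere only. -/
def HasMeasurableSolution {G 𝕜 : Type*} [Group G] [MeasurableSpace G] [RCLike 𝕜]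
    (ν : Measure G) (g : G) (γ : G → 𝕜) : Prop :=
  ∃ φ : G → 𝕜, AEMeasurable φ ν ∧ ∀ᵐ x ∂ν, φ (g * x) - φ x = γ x

/-- The space of continuous functions on `G` with zero integral, with the topology induced from
`C(G, 𝕜)`; for compact `G` this is the topology of the uniform norm. -/
abbrev ZeroMeanFunctions {G : Type*} [TopologicalSpace G] [MeasurableSpace G]
    (ν : Measure G) (𝕜 : Type*) [RCLike 𝕜] : Type _ :=
  {γ : C(G, 𝕜) // ∫ x, γ x ∂ν = 0}

open Filter Topology
open scoped ENNReal

/-! ### Alternating blocks of integers. -/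

section BlockSums

/-! If `φ` solves the equation, the Birkhoff sums of `γ` telescope to `φ (g ^ n * x) - φ x`, hence
are bounded in probability uniformly in `n`. So the solvable `γ` lie in the countable union of the
sets `tightSums` (`setOf_hasMeasurableSolution_subset`), which are closed (`isClosed_tightSums`).

They have empty interior (`interior_tightSums`), because uniformly small continuous coboundaries can
have large Birkhoff sums with probability at least 1/4. For this, `exists_continuousMap_large_sums`
measures the time since the last visit to a tiny neighbourhood of `1`, cuts it into alternating
blocks of length `2 * p`, and approximates the indicator of the even blocks by a continuous `u`; the
sums of `u - u ∘ g ^ (2 * p)` over suitable windows of length `p` are `±p`. Baire's theorem does the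
rest. -/

/-- The indicator of the even blocks of length `2 * p` in `ℕ`. -/
noncomputable def evenBlock (p k : ℕ) : ℝ := if Even (k / (2 * p)) then 1 else 0

/-- A window of length `p` starting in the first half of a block stays in that block, and its shift
by `2 * p` stays in the next one, of opposite parity. All differences thus have the same sign. -/
lemma abs_sum_evenBlock_sub {p k : ℕ} (hk : k % (2 * p) < p) :
    |∑ i ∈ Finset.range p, (evenBlock p (k + i) - evenBlock p (k + (2 * p + i)))| = p := by
  have hp : 0 < 2 * p := by omega
  have key : ∀ i ∈ Finset.range p, evenBlock p (k + i) - evenBlock p (k + (2 * p + i)) =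
      if Even (k / (2 * p)) then 1 else -1 := by
    intro i hi
    have hi' := Finset.mem_range.1 hi
    have h1 : (k + i) / (2 * p) = k / (2 * p) := by
      rw [Nat.add_div hp, Nat.mod_eq_of_lt (by omega : i < 2 * p),
        Nat.div_eq_of_lt (by omega : i < 2 * p), if_neg (by omega)]
      rfl
    have h2 : (k + (2 * p + i)) / (2 * p) = k / (2 * p) + 1 := by
      rw [show k + (2 * p + i) = (k + i) + 2 * p by ring, Nat.add_div_right _ hp, h1]
    unfold evenBlock
    rw [h1, h2]
    by_cases h : Even (k / (2 * p)) <;> simp [h, Nat.even_add_one]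
  rw [Finset.sum_congr rfl key, Finset.sum_const, Finset.card_range, nsmul_eq_mul, abs_mul]
  split_ifs <;> simp

lemma mod_lt_or_add_mod_lt {p : ℕ} (hp : 0 < p) (k : ℕ) :
    k % (2 * p) < p ∨ (k + p) % (2 * p) < p := by
  by_cases h : k % (2 * p) < p
  · exact Or.inl h
  · right
    have h1 : k % (2 * p) < 2 * p := Nat.mod_lt _ (by omega)
    have h2 : (k + p) % (2 * p) = (k % (2 * p) + p) % (2 * p) := by simp [Nat.add_mod]
    rw [h2, Nat.mod_eq_sub_mod (by omega), Nat.mod_eq_of_lt (by omega)]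
    omega

end BlockSums

/-! ### Visits of orbits to open sets. -/

section Monothetic

variable {G : Type*} [Group G] [TopologicalSpace G] [IsTopologicalGroup G] [CompactSpace G]

/-- Every orbit of the backward translation by a generator visits a given nonempty open set. -/
lemma IsMonotheticGenerator.exists_inv_pow_mul_mem {g : G} (hg : IsMonotheticGenerator g)
    {V : Set G} (hV : IsOpen V) (hne : V.Nonempty) (x : G) :
    ∃ k : ℕ, (g ^ k)⁻¹ * x ∈ V := by
  have hcover : (Set.univ : Set G) ⊆ ⋃ k : ℤ, {y | g ^ k * y ∈ V} := by
    intro y _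
    obtain ⟨v, hv⟩ := hne
    have ho : IsOpen {z : G | z * y ∈ V} := hV.preimage (continuous_mul_const y)
    obtain ⟨z, hz, hz'⟩ := hg.inter_open_nonempty _ ho ⟨v * y⁻¹, by simpa using hv⟩
    obtain ⟨k, rfl⟩ := Subgroup.mem_zpowers_iff.1 hz'
    exact Set.mem_iUnion.2 ⟨k, hz⟩
  obtain ⟨t, ht⟩ := isCompact_univ.elim_finite_subcover _
    (fun k : ℤ => hV.preimage (continuous_const_mul (g ^ k))) hcover
  -- Starting from `(g ^ K)⁻¹ * x` makes every exponent `k - K` of the finite subcover nonpositive.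
  obtain ⟨K, hK⟩ : ∃ K : ℤ, ∀ k ∈ t, k ≤ K := t.bddAbove
  obtain ⟨k, hk, hkV⟩ := Set.mem_iUnion₂.1 (ht (Set.mem_univ ((g ^ K)⁻¹ * x)))
  refine ⟨(K - k).toNat, ?_⟩
  have : (g ^ (K - k).toNat)⁻¹ * x = g ^ k * ((g ^ K)⁻¹ * x) := by
    rw [← mul_assoc]
    congr 1
    rw [← zpow_natCast, Int.toNat_of_nonneg (sub_nonneg.2 (hK k hk)), ← zpow_neg, ← zpow_neg,
      ← zpow_add]
    congr 1
    ring
  rw [this]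
  exact hkV

end Monothetic

/-! ### Continuous functions with large Birkhoff sums. -/

section Tower

variable {G : Type*} [Group G] [TopologicalSpace G] [IsTopologicalGroup G] [T2Space G]
  [CompactSpace G] [MeasurableSpace G] [BorelSpace G]

/-- An infinite compact group is not discrete, so its Haar measure has no atoms; outer regularity at
`{1}` gives `V`. -/
lemma exists_isOpen_one_mem_measure_lt [Infinite G] (ν : Measure G) [ν.IsHaarMeasure]
    [ν.Regular] {ε : ℝ≥0∞} (hε : 0 < ε) : ∃ V : Set G, IsOpen V ∧ (1 : G) ∈ V ∧ ν V < ε := by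
  have hnd : ¬ DiscreteTopology G := fun _ =>
    not_finite_iff_infinite.2 ‹_› finite_of_compact_of_discrete
  have hne : (𝓝[≠] (1 : G)).NeBot := by
    by_contra h
    exact hnd (discreteTopology_of_isOpen_singleton_one
      (isOpen_singleton_iff_punctured_nhds _ |>.2 (not_neBot.1 h)))
  obtain ⟨V, hV, hVo, hVε⟩ := ({(1 : G)} : Set G).exists_isOpen_lt_of_lt (μ := ν) ε (by simpa)
  exact ⟨V, hVo, hV rfl, hVε⟩

/-- A Borel set can be approximated in measure by a continuous function with values in `[0, 1]`. -/
lemma exists_continuousMap_measure_ne_indicator_lt (ν : Measure G) [IsFiniteMeasure ν] [ν.Regular]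
    {A : Set G} (hA : MeasurableSet A) {ε : ℝ≥0∞} (hε : ε ≠ 0) :
    ∃ u : C(G, ℝ), (∀ x, u x ∈ Set.Icc (0 : ℝ) 1) ∧
      ν {x | u x ≠ A.indicator 1 x} < ε := by
  have hε2 : ε / 2 ≠ 0 := by simpa using hε
  obtain ⟨K, hKA, hK, hKε⟩ := hA.exists_isCompact_sdiff_lt (measure_ne_top ν A) hε2
  obtain ⟨L, hLA, hL, hLε⟩ := hA.compl.exists_isCompact_sdiff_lt (measure_ne_top ν Aᶜ) hε2
  obtain ⟨u, hu0, hu1, hu⟩ := exists_continuous_zero_one_of_isClosed hL.isClosed hK.isClosed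
    (Set.disjoint_left.2 fun x hx hx' => hLA hx (hKA hx'))
  refine ⟨u, hu, ?_⟩
  calc ν {x | u x ≠ A.indicator 1 x} ≤ ν (A \ K ∪ Aᶜ \ L) := by
        refine measure_mono fun x hx => ?_
        by_cases hxA : x ∈ A
        · exact Or.inl ⟨hxA, fun hxK => hx (by simp [hxA, hu1 hxK])⟩
        · exact Or.inr ⟨hxA, fun hxL => hx (by simp [hxA, hu0 hxL])⟩
    _ ≤ ν (A \ K) + ν (Aᶜ \ L) := measure_union_le _ _
    _ < ε / 2 + ε / 2 := ENNReal.add_lt_add hKε hLε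
    _ = ε := ENNReal.add_halves ε

/-- Coboundaries of continuous functions with values in `[0, 1]` may have Birkhoff sums that are
large on a set of measure bounded below. -/
lemma exists_continuousMap_large_sums [Infinite G] (ν : Measure G) [ν.IsHaarMeasure] [ν.Regular]
    [IsProbabilityMeasure ν] {g : G} (hg : IsMonotheticGenerator g) {p : ℕ} (hp : 0 < p) :
    ∃ u : C(G, ℝ), (∀ x, u x ∈ Set.Icc (0 : ℝ) 1) ∧
      4⁻¹ ≤ ν {x | (p : ℝ) ≤
        |∑ i ∈ Finset.range p, (u (g ^ i * x) - u (g ^ (2 * p) * (g ^ i * x)))|} := by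
  classical
  -- The exponents used below are less than `4 * p`: the window, its shift by `2 * p`, and a further
  -- shift by `p`. With `ε = 1 / (4 * N)`, the `N` translates of `Z` have total measure at most 1/2.
  set N : ℕ := 4 * p + 1 with hN
  set ε : ℝ≥0∞ := (4 * N : ℝ≥0∞)⁻¹ with hε
  have hε0 : ε ≠ 0 := by
    rw [hε]
    exact ENNReal.inv_ne_zero.2 (ENNReal.mul_ne_top (by simp) (by simp))
  obtain ⟨V, hVo, hV1, hVε⟩ := exists_isOpen_one_mem_measure_lt ν (pos_iff_ne_zero.2 hε0)
  have hex := hg.exists_inv_pow_mul_mem hVo ⟨1, hV1⟩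
  -- The time since the last visit to `V`; it grows by one at each step that does not enter `V`.
  set r : G → ℕ := fun x => Nat.find (hex x) with hr
  have hrm : Measurable r := measurable_find hex fun k =>
    (hVo.preimage (continuous_const_mul _)).measurableSet
  have hstep : ∀ x, g * x ∉ V → r (g * x) = r x + 1 := by
    intro x hx
    have h0 : ¬ ((g ^ 0)⁻¹ * (g * x) ∈ V) := by simpa using hx
    have hsucc : ∀ k : ℕ, (g ^ (k + 1))⁻¹ * (g * x) = (g ^ k)⁻¹ * x := by
      intro k
      rw [pow_succ']
      group
    refine (Nat.find_eq_iff _).2 ⟨?_, ?_⟩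
    · rw [hsucc]
      exact Nat.find_spec (hex x)
    · intro m hm
      rcases m with _ | m
      · exact h0
      · rw [hsucc]
        exact Nat.find_min (hex x) (Nat.lt_of_succ_lt_succ hm)
  set A : Set G := {x | Even (r x / (2 * p))} with hA
  have hAm : MeasurableSet A := hrm (MeasurableSet.of_discrete (s := {k : ℕ | Even (k / (2 * p))}))
  obtain ⟨u, hu, huε⟩ := exists_continuousMap_measure_ne_indicator_lt ν hAm hε0
  have hind : ∀ x, A.indicator 1 x = evenBlock p (r x) := fun x => by
    simp [Set.indicator_apply, hA, evenBlock]
  refine ⟨u, hu, ?_⟩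
  set W : Set G := {x | (p : ℝ) ≤
    |∑ i ∈ Finset.range p, (u (g ^ i * x) - u (g ^ (2 * p) * (g ^ i * x)))|} with hW
  set Z : Set G := V ∪ {x | u x ≠ A.indicator 1 x} with hZ
  set B : Set G := ⋃ i ∈ Finset.range N, (fun x => g ^ i * x) ⁻¹' Z with hB
  -- Off `B`, `u` follows `evenBlock` for `N` steps, and the window starting at time `0` or the one
  -- at time `p` begins in the first half of a block.
  have hcover : (Set.univ : Set G) ⊆ B ∪ (W ∪ (fun x => g ^ p * x) ⁻¹' W) := by
    intro x _
    by_cases hxB : x ∈ B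
    · exact Or.inl hxB
    right
    have hx : ∀ i < N, g ^ i * x ∉ V ∧ u (g ^ i * x) = evenBlock p (r (g ^ i * x)) := by
      intro i hi
      have : g ^ i * x ∉ Z := fun h => hxB (Set.mem_iUnion₂.2 ⟨i, Finset.mem_range.2 hi, h⟩)
      rw [hZ, Set.mem_union, not_or] at this
      exact ⟨this.1, by simpa [hind] using this.2⟩
    have hrx : ∀ i < N, r (g ^ i * x) = r x + i := by
      intro i
      induction i with
      | zero => simp
      | succ i ih =>
        intro hi
        have h1 := (hx (i + 1) hi).1
        rw [pow_succ', mul_assoc] at h1 ⊢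
        rw [hstep _ h1, ih (by omega)]
        ring
    have hux : ∀ i < N, u (g ^ i * x) = evenBlock p (r x + i) := fun i hi => by
      rw [(hx i hi).2, hrx i hi]
    rcases mod_lt_or_add_mod_lt hp (r x) with h | h
    · left
      change (p : ℝ) ≤ _
      rw [← abs_sum_evenBlock_sub h]
      refine le_of_eq (congrArg _ (Finset.sum_congr rfl fun i hi => ?_))
      have hi' := Finset.mem_range.1 hi
      rw [← mul_assoc, ← pow_add, hux _ (by omega), hux _ (by omega)]
    · right
      change (p : ℝ) ≤ _
      rw [← abs_sum_evenBlock_sub h]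
      refine le_of_eq (congrArg _ (Finset.sum_congr rfl fun i hi => ?_))
      have hi' := Finset.mem_range.1 hi
      rw [← mul_assoc, ← mul_assoc, ← pow_add, ← pow_add, hux _ (by omega), hux _ (by omega)]
      congr 2 <;> ring
  have hνB : ν B ≤ 2⁻¹ := by
    calc ν B ≤ ∑ i ∈ Finset.range N, ν ((fun x => g ^ i * x) ⁻¹' Z) :=
          measure_biUnion_finset_le _ _
      _ = N * ν Z := by simp [measure_preimage_mul]
      _ ≤ N * (ε + ε) := by
          gcongr
          exact (measure_union_le _ _).trans (add_le_add hVε.le huε.le)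
      _ = 2⁻¹ := by
          have hN0 : (N : ℝ≥0∞) ≠ 0 := by simp [hN]
          have h4 : (4 : ℝ≥0∞) = 2 * 2 := by norm_num
          rw [hε, ENNReal.mul_inv (by simp) (by simp), ← two_mul, h4,
            ENNReal.mul_inv (by simp) (by simp)]
          calc (N : ℝ≥0∞) * (2 * (2⁻¹ * 2⁻¹ * (N : ℝ≥0∞)⁻¹))
              = (N * (N : ℝ≥0∞)⁻¹) * (2 * 2⁻¹) * 2⁻¹ := by ring
            _ = 2⁻¹ := by
              rw [ENNReal.mul_inv_cancel hN0 (by simp),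
                ENNReal.mul_inv_cancel (by simp) (by simp)]
              simp
  have hle : (1 : ℝ≥0∞) ≤ 2⁻¹ + (ν W + ν W) := by
    calc (1 : ℝ≥0∞) = ν Set.univ := measure_univ.symm
      _ ≤ ν (B ∪ (W ∪ (fun x => g ^ p * x) ⁻¹' W)) := measure_mono hcover
      _ ≤ ν B + (ν W + ν ((fun x => g ^ p * x) ⁻¹' W)) :=
          (measure_union_le _ _).trans (by gcongr; exact measure_union_le _ _)
      _ ≤ 2⁻¹ + (ν W + ν W) := by
          rw [measure_preimage_mul]
          gcongr
  by_contra! hlt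
  have h2 : (2⁻¹ : ℝ≥0∞) + (4⁻¹ + 4⁻¹) = 1 := by
    rw [← ENNReal.toReal_eq_one_iff, ENNReal.toReal_add (by simp) (by simp),
      ENNReal.toReal_add (by simp) (by simp)]
    norm_num
  have h3 : (2⁻¹ : ℝ≥0∞) + (ν W + ν W) < 2⁻¹ + (4⁻¹ + 4⁻¹) :=
    ENNReal.add_lt_add_left (by simp) (ENNReal.add_lt_add hlt hlt)
  exact absurd hle (not_le.2 (h2 ▸ h3))

end Tower

/-! ### The category argument. -/

section Cohomological

variable {G : Type*} [Group G] [TopologicalSpace G] [IsTopologicalGroup G] [CompactSpace G]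
  [MeasurableSpace G] [BorelSpace G] {𝕜 : Type*} [RCLike 𝕜]

/-- The functions of zero mean whose Birkhoff sums exceed `M` with probability at most `1 / 16`. -/
def tightSums (ν : Measure G) (g : G) (𝕜 : Type*) [RCLike 𝕜] (M : ℕ) :
    Set (ZeroMeanFunctions ν 𝕜) :=
  {γ | ∀ n : ℕ, ν {x | (M : ℝ) < ‖∑ i ∈ Finset.range n, γ.1 (g ^ i * x)‖} ≤ 16⁻¹}

/-- The inequality `M < ‖·‖` is open, so the set for the limit lies in the lower limit of the sets
along the sequence; continuity from below keeps the bound. -/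
lemma isClosed_tightSums (ν : Measure G) (g : G) (M : ℕ) :
    IsClosed (tightSums ν g 𝕜 M) := by
  have hrw : tightSums ν g 𝕜 M = ⋂ n : ℕ, {γ : ZeroMeanFunctions ν 𝕜 |
      ν {x | (M : ℝ) < ‖∑ i ∈ Finset.range n, γ.1 (g ^ i * x)‖} ≤ 16⁻¹} := by
    ext γ
    simp [tightSums]
  rw [hrw]
  refine isClosed_iInter fun n => isSeqClosed_iff_isClosed.1 fun γ γ₀ hγ hlim => ?_
  have hpt : ∀ x, Tendsto (fun k => ‖∑ i ∈ Finset.range n, (γ k).1 (g ^ i * x)‖) atTop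
      (𝓝 ‖∑ i ∈ Finset.range n, γ₀.1 (g ^ i * x)‖) := fun x => by
    have hc : Continuous fun γ : ZeroMeanFunctions ν 𝕜 =>
        ‖∑ i ∈ Finset.range n, γ.1 (g ^ i * x)‖ :=
      (continuous_finsetSum _ fun i _ =>
        (continuous_eval_const (F := C(G, 𝕜)) _).comp continuous_subtype_val).norm
    exact (hc.tendsto γ₀).comp hlim
  have hmono : Monotone fun k₀ : ℕ =>
      ⋂ k ≥ k₀, {x | (M : ℝ) < ‖∑ i ∈ Finset.range n, (γ k).1 (g ^ i * x)‖} :=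
    fun a b hab => Set.biInter_mono (fun _ hk => le_trans hab hk) fun _ _ => le_rfl
  calc ν {x | (M : ℝ) < ‖∑ i ∈ Finset.range n, γ₀.1 (g ^ i * x)‖}
      ≤ ν (⋃ k₀ : ℕ, ⋂ k ≥ k₀,
          {x | (M : ℝ) < ‖∑ i ∈ Finset.range n, (γ k).1 (g ^ i * x)‖}) := by
        refine measure_mono fun x hx => ?_
        obtain ⟨k₀, hk₀⟩ := eventually_atTop.1 ((hpt x).eventually_const_lt hx)
        exact Set.mem_iUnion.2 ⟨k₀, Set.mem_iInter₂.2 hk₀⟩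
    _ = ⨆ k₀ : ℕ, ν (⋂ k ≥ k₀,
          {x | (M : ℝ) < ‖∑ i ∈ Finset.range n, (γ k).1 (g ^ i * x)‖}) := hmono.measure_iUnion
    _ ≤ 16⁻¹ := iSup_le fun k₀ =>
        (measure_mono (Set.biInter_subset_of_mem (Set.mem_Ici.2 le_rfl))).trans (hγ k₀)

lemma setOf_hasMeasurableSolution_subset (ν : Measure G) [ν.IsHaarMeasure]
    [IsProbabilityMeasure ν] (g : G) :
    {γ : ZeroMeanFunctions ν 𝕜 | HasMeasurableSolution ν g γ.1} ⊆
      ⋃ M, tightSums ν g 𝕜 M := by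
  rintro γ ⟨φ, hφ, heq⟩
  have htend : Tendsto (fun M : ℕ => ν {x | (M : ℝ) < ‖φ x‖}) atTop (𝓝 0) := by
    have hanti : Antitone fun M : ℕ => {x | (M : ℝ) < ‖φ x‖} := 
      fun M M' h x (hx : (M' : ℝ) < ‖φ x‖) => lt_of_le_of_lt (Nat.cast_le.2 h) hx
    have hemp : ⋂ M : ℕ, {x | (M : ℝ) < ‖φ x‖} = ∅ := by
      ext x
      obtain ⟨M, hM⟩ := exists_nat_ge ‖φ x‖
      simpa using ⟨M, hM⟩
    have := tendsto_measure_iInter_atTop (μ := ν)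
      (fun M : ℕ => nullMeasurableSet_lt aemeasurable_const hφ.norm) hanti
      ⟨0, measure_ne_top ν _⟩
    rwa [hemp, measure_empty] at this
  -- A sum exceeds `2 * M` only if `φ` exceeds `M` at `x` or at `g ^ n * x`: probability at most
  -- 2/32.
  obtain ⟨M, hM⟩ := (htend.eventually_lt_const (show (0 : ℝ≥0∞) < 32⁻¹ by simp)).exists
  refine Set.mem_iUnion.2 ⟨2 * M, fun n => ?_⟩
  have hall : ∀ᵐ x ∂ν, ∀ i : ℕ, φ (g * (g ^ i * x)) - φ (g ^ i * x) = γ.1 (g ^ i * x) :=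
    ae_all_iff.2 fun i => (measurePreserving_mul_left ν (g ^ i)).quasiMeasurePreserving.ae heq
  have hsum : ∀ᵐ x ∂ν, ∑ i ∈ Finset.range n, γ.1 (g ^ i * x) = φ (g ^ n * x) - φ x := by
    filter_upwards [hall] with x hx
    have := Finset.sum_range_sub (fun i => φ (g ^ i * x)) n
    simp only [pow_zero, one_mul] at this
    rw [← this]
    exact Finset.sum_congr rfl fun i _ => by rw [← hx i, pow_succ', mul_assoc]
  set E : Set G := {x | (M : ℝ) < ‖φ x‖} with hE
  calc ν {x | ((2 * M : ℕ) : ℝ) < ‖∑ i ∈ Finset.range n, γ.1 (g ^ i * x)‖}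
      ≤ ν ((fun x => g ^ n * x) ⁻¹' E ∪ E) := by
        refine measure_mono_ae ?_
        filter_upwards [hsum] with x hx hlt
        change ((2 * M : ℕ) : ℝ) < _ at hlt
        rw [hx] at hlt
        by_contra hcon
        replace hcon : ¬ (x ∈ (fun x => g ^ n * x) ⁻¹' E ∪ E) := hcon
        rw [Set.mem_union, not_or] at hcon
        have h1 : ‖φ (g ^ n * x)‖ ≤ M := not_lt.1 hcon.1
        have h2 : ‖φ x‖ ≤ M := not_lt.1 hcon.2
        have h3 := norm_sub_le (φ (g ^ n * x)) (φ x)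
        push_cast at hlt
        linarith
    _ ≤ ν E + ν E := (measure_union_le _ _).trans (by rw [measure_preimage_mul])
    _ ≤ 32⁻¹ + 32⁻¹ := add_le_add hM.le hM.le
    _ = 16⁻¹ := by
        rw [← ENNReal.toReal_eq_toReal_iff' (by simp) (by simp),
          ENNReal.toReal_add (by simp) (by simp)]
        norm_num

/-- If `γ₀` and its perturbation by `ε / 2` times the coboundary of `u` were both in the set, the
sums of the difference would exceed `2 * M` with probability at most 1/8, not 1/4. -/
lemma interior_tightSums [T2Space G] [Infinite G] (ν : Measure G) [ν.IsHaarMeasure] [ν.Regular]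
    [IsProbabilityMeasure ν] {g : G} (hg : IsMonotheticGenerator g) (M : ℕ) :
    interior (tightSums ν g 𝕜 M) = ∅ := by
  rw [Set.eq_empty_iff_forall_notMem]
  intro γ₀ hγ₀
  obtain ⟨ε, hε, hball⟩ := Metric.mem_nhds_iff.1 (mem_interior_iff_mem_nhds.1 hγ₀)
  -- This makes `ε / 2 * p > 2 * M`.
  obtain ⟨p, hp⟩ := exists_nat_gt (4 * M / ε)
  have hp0 : 0 < p := by
    have : (0 : ℝ) ≤ 4 * M / ε := by positivity
    exact_mod_cast this.trans_lt hp
  obtain ⟨u, hu, hνu⟩ := exists_continuousMap_large_sums ν hg hp0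
  let β : C(G, ℝ) := u - u.comp ⟨fun x => g ^ (2 * p) * x, continuous_const_mul _⟩
  have hβ : ∀ x, β x = u x - u (g ^ (2 * p) * x) := fun x => rfl
  have hβ1 : ∀ x, |β x| ≤ 1 := fun x => by
    rw [hβ]
    exact abs_sub_le_of_nonneg_of_le (hu _).1 (hu _).2 (hu _).1 (hu _).2
  have hβint : ∫ x, β x ∂ν = 0 := by
    have hui : Integrable u ν := u.continuous.integrable_of_hasCompactSupport
      (HasCompactSupport.of_compactSpace _)
    simp only [hβ]
    rw [integral_sub hui (hui.comp_mul_left _), integral_mul_left_eq_self (fun x => u x), sub_self]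
  let δ : C(G, 𝕜) := ⟨fun x => (((ε / 2) * β x : ℝ) : 𝕜),
    RCLike.continuous_ofReal.comp (continuous_const.mul β.continuous)⟩
  have hδ : ∀ x, δ x = (((ε / 2) * β x : ℝ) : 𝕜) := fun x => rfl
  have hint : ∀ f : C(G, 𝕜), Integrable f ν := fun f =>
    f.continuous.integrable_of_hasCompactSupport (HasCompactSupport.of_compactSpace _)
  have hδint : ∫ x, δ x ∂ν = 0 := by
    simp only [hδ]
    rw [integral_ofReal, integral_const_mul, hβint]
    simp
  let γ₁ : ZeroMeanFunctions ν 𝕜 := ⟨γ₀.1 + δ, by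
    simp only [ContinuousMap.add_apply]
    rw [integral_add (hint _) (hint _), γ₀.2, hδint, add_zero]⟩
  have hγ₁ : γ₁ ∈ tightSums ν g 𝕜 M := by
    refine hball ?_
    rw [Metric.mem_ball, Subtype.dist_eq, dist_eq_norm]
    change ‖γ₀.1 + δ - γ₀.1‖ < ε
    rw [add_sub_cancel_left]
    refine lt_of_le_of_lt ((ContinuousMap.norm_le _ (half_pos hε).le).2 fun x => ?_)
      (half_lt_self hε)
    rw [hδ, RCLike.norm_ofReal, abs_mul, abs_of_pos (half_pos hε)]
    exact mul_le_of_le_one_right (half_pos hε).le (hβ1 x)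
  have hsub : {x | (p : ℝ) ≤
      |∑ i ∈ Finset.range p, (u (g ^ i * x) - u (g ^ (2 * p) * (g ^ i * x)))|} ⊆
      {x | (M : ℝ) < ‖∑ i ∈ Finset.range p, γ₁.1 (g ^ i * x)‖} ∪
      {x | (M : ℝ) < ‖∑ i ∈ Finset.range p, γ₀.1 (g ^ i * x)‖} := by
    intro x hx
    by_contra hcon
    rw [Set.mem_union, not_or] at hcon
    have h1 : ‖∑ i ∈ Finset.range p, γ₁.1 (g ^ i * x)‖ ≤ M := not_lt.1 hcon.1
    have h2 : ‖∑ i ∈ Finset.range p, γ₀.1 (g ^ i * x)‖ ≤ M := not_lt.1 hcon.2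
    have h3 : ∑ i ∈ Finset.range p, γ₁.1 (g ^ i * x) - ∑ i ∈ Finset.range p, γ₀.1 (g ^ i * x) =
        ((ε / 2 * ∑ i ∈ Finset.range p,
          (u (g ^ i * x) - u (g ^ (2 * p) * (g ^ i * x))) : ℝ) : 𝕜) := by
      rw [← Finset.sum_sub_distrib, Finset.mul_sum, RCLike.ofReal_sum]
      refine Finset.sum_congr rfl fun i _ => ?_
      change γ₀.1 _ + δ _ - γ₀.1 _ = _
      rw [add_sub_cancel_left, hδ, hβ]
    have h4 := norm_sub_le (∑ i ∈ Finset.range p, γ₁.1 (g ^ i * x))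
      (∑ i ∈ Finset.range p, γ₀.1 (g ^ i * x))
    rw [h3, RCLike.norm_ofReal, abs_mul, abs_of_pos (half_pos hε)] at h4
    have h5 : ε / 2 * p ≤ ε / 2 * _ := mul_le_mul_of_nonneg_left hx (half_pos hε).le
    rw [div_lt_iff₀ hε] at hp
    linarith
  have hle : (4⁻¹ : ℝ≥0∞) ≤ 16⁻¹ + 16⁻¹ :=
    hνu.trans ((measure_mono hsub).trans ((measure_union_le _ _).trans
      (add_le_add (hγ₁ p) (interior_subset hγ₀ p))))
  rw [← ENNReal.toReal_le_toReal (by simp) (by simp), ENNReal.toReal_add (by simp) (by simp)] at hle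
  norm_num at hle

end Cohomological

theorem theorem12p1 {G : Type*} [Group G] [TopologicalSpace G] [IsTopologicalGroup G]
    [T2Space G] [CompactSpace G] [Infinite G] [MeasurableSpace G] [BorelSpace G]
    (ν : Measure G) [ν.IsHaarMeasure] [ν.Regular] [IsProbabilityMeasure ν]
    (g : G) (hg : IsMonotheticGenerator g) (𝕜 : Type*) [RCLike 𝕜] :
    (∃ γ : C(G, 𝕜), ∫ x, γ x ∂ν = 0 ∧ ¬ HasMeasurableSolution ν g γ) ∧
    IsMeagre {γ : ZeroMeanFunctions ν 𝕜 | HasMeasurableSolution ν g γ.1} ∧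
    ¬ IsMeagre {γ : ZeroMeanFunctions ν 𝕜 | ¬ HasMeasurableSolution ν g γ.1} := by
  have hmeagre : IsMeagre {γ : ZeroMeanFunctions ν 𝕜 | HasMeasurableSolution ν g γ.1} := by
    refine IsMeagre.mono (setOf_hasMeasurableSolution_subset ν g) ?_
    exact isMeagre_iUnion fun M => ((isClosed_tightSums ν g M).isNowhereDense_iff.2
      (interior_tightSums ν hg M)).isMeagre
  have hint : ∀ f : C(G, 𝕜), Integrable f ν := fun f =>
    f.continuous.integrable_of_hasCompactSupport (HasCompactSupport.of_compactSpace _)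
  have hclosed : IsClosed {γ : C(G, 𝕜) | ∫ x, γ x ∂ν = 0} := by
    have hc : Continuous fun γ : C(G, 𝕜) => ∫ x, γ x ∂ν := by
      refine (LipschitzWith.of_dist_le_mul (K := 1) fun γ γ' => ?_).continuous
      rw [dist_eq_norm, dist_eq_norm, ← integral_sub (hint γ) (hint γ')]
      have := norm_integral_le_of_norm_le_const (μ := ν)
        (ae_of_all ν fun x => (γ - γ').norm_coe_le_norm x)
      simpa using this
    exact isClosed_eq hc continuous_const
  have : CompleteSpace (ZeroMeanFunctions ν 𝕜) := hclosed.completeSpace_coe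
  have : Nonempty (ZeroMeanFunctions ν 𝕜) := ⟨⟨0, by simp⟩⟩
  have hnot : ¬ IsMeagre {γ : ZeroMeanFunctions ν 𝕜 | ¬ HasMeasurableSolution ν g γ.1} := by
    intro h
    have hres : {γ : ZeroMeanFunctions ν 𝕜 | HasMeasurableSolution ν g γ.1} ∈
        residual (ZeroMeanFunctions ν 𝕜) := by
      simpa [IsMeagre, Set.compl_ofPred] using h
    have := dense_of_mem_residual (inter_mem hres hmeagre)
    obtain ⟨γ, hγ⟩ := this.nonempty
    exact hγ.2 hγ.1
  refine ⟨?_, hmeagre, hnot⟩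
  by_contra! h
  refine hnot ?_
  convert IsMeagre.empty
  exact Set.eq_empty_of_forall_notMem fun γ hγ => hγ (h γ.1 γ.2)
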